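/- Notation. For an open interval $T\subset\mathbb R$ let $\mathbb C_T=(\mathbb C\setminus\mathbb R)\cup T$. Two real numbers $x,y$ are $K$-commensurable if $K^{-1}\le |x|/|y|\le K$. For intervals $I,J\subset\mathbb R$, $|J|$ denotes length and $\operatorname{dist}(I,J)=\inf\{|x-y|:x\in I,\ y\in J\}$. An orientation preserving homeomorphism $g:I=[0,a]\to J=[g(0),g(a)]$, $a>0$, belongs to the Epstein class $\mathcal E$ if it extends to an analytic three-fold branched covering $g:G\to\mathbb C_{\tilde J}$ of a topological disk $G\supset I$ onto the double-slit plane over a bounded open interval $\tilde J\supset J$, whose only branch point is $0$, with local degree three there. For $s\in(0,1)$, $\mathcal E_s$ consists of those $g\in\mathcal E$ for which $G$ and $\tilde J$ can be taken so that: $|I|$ is $s^{-1}$-commensurable with $|J|$, $\operatorname{dist}(I,J)\le s^{-1}|J|$ (in particular $I$ and $J$ may overlap), each of the two components of $\tilde J\setminus J$ has length at least $s|J|$, and $g'(a)>s$. A map $h$ univalent on $G$ is the univalent factor of $g$ if, on $G$, $g=Q_c\circ h$ with $Q_c(z)=z^3+c$, where $h$ maps $G$ bijectively onto the six-slit plane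 $Q_c^{-1}(\mathbb C_{\tilde J})$ and maps $I$ onto $[0,b]$ for some $b>0$. Lemma. For every $s\in(0,1)$ there are a domain (open connected set) $O_s\subset\mathbb C$ with $O_s\supset[0,1]$ and a constant $K(s)$ such that for every $g\in\mathcal E_s$ normalized by $I=[0,1]$, and every choice of $\tilde J$ and of the extension $g:G\to\mathbb C_{\tilde J}$ as in the definition of $\mathcal E_s$: one has $O_s\subset G$, a univalent factor $h$ of $g$ exists on $G$ (so it is defined on $O_s$), and every such $h$ has $K(s)$-bounded distortion on $O_s$, i.e. $|h'(z)|\le K(s)\,|h'(w)|$ for all $z,w\in O_s$. -/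

import Mathlib

/-- The plane slit along the part of the real axis outside `T`, that is `(ℂ ∖ ℝ) ∪ T`. -/
def slitPlaneOver (T : Set ℝ) : Set ℂ := {z | z.im ≠ 0 ∨ z.re ∈ T}

/-- `x` and `y` are `K`-commensurable. -/
def KCommensurable (K x y : ℝ) : Prop := K⁻¹ ≤ |x| / |y| ∧ |x| / |y| ≤ K

/-- Euclidean distance between two subsets of the line (used for nonempty sets only). -/
noncomputable def setDist (A B : Set ℝ) : ℝ := sInf (Set.image2 dist A B)

/-- An open subset of the plane that is homeomorphic to the open unit disk. -/
structure IsTopologicalDisk (G : Set ℂ) : Prop where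
  isOpen : IsOpen G
  homeo : Nonempty (G ≃ₜ Metric.ball (0 : ℂ) 1)

/-- `F` restricts to an analytic `d`-fold branched covering of `G` onto `V`: a proper analytic map
from `G` to `V` such that every point of `V` has exactly `d` preimages in `G`, counted with
multiplicity. -/
structure IsBranchedCover (d : ℕ) (F : ℂ → ℂ) (G V : Set ℂ) : Prop where
  analytic : AnalyticOnNhd ℂ F G
  mapsTo : Set.MapsTo F G V
  proper : ∀ K : Set ℂ, K ⊆ V → IsCompact K → IsCompact (G ∩ F ⁻¹' K)
  degree : ∀ w ∈ V, ∑ᶠ z ∈ G ∩ F ⁻¹' {w}, analyticOrderNatAt (fun ζ => F ζ - w) z = d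

/-- The Epstein class. The map `g`, restricted to `I = [0,a]`, is an orientation preserving
homeomorphism onto `J = [g 0, g a]`; it extends to an analytic three-fold branched covering `F` of
the topological disk `G ⊇ I` onto the double-slit plane over `J' = (p,q) ⊇ J`, and the only branch
point of `F` in `G` is `0`, where the local degree is three. -/
structure IsEpsteinMap (a : ℝ) (g : ℝ → ℝ) (p q : ℝ) (G : Set ℂ) (F : ℂ → ℂ) : Prop where
  a_pos : 0 < a
  continuousOn : ContinuousOn g (Set.Icc 0 a)
  strictMonoOn : StrictMonoOn g (Set.Icc 0 a)
  subset_slit : Set.Icc (g 0) (g a) ⊆ Set.Ioo p q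
  disk : IsTopologicalDisk G
  interval_subset : ∀ x ∈ Set.Icc 0 a, (x : ℂ) ∈ G
  extends_map : ∀ x ∈ Set.Icc 0 a, F (x : ℂ) = (g x : ℂ)
  cover : IsBranchedCover 3 F G (slitPlaneOver (Set.Ioo p q))
  branch_zero : analyticOrderAt (fun z => F z - F 0) 0 = 3
  branch_only : ∀ z ∈ G, z ≠ 0 → deriv F z ≠ 0

/-- The Epstein class with constant `s`. Here `|I| = a`, `|J| = g a - g 0`, and the two components
of `J' ∖ J` are `(p, g 0)` and `(g a, q)`. Of the commensurability of `dist(I,J)` with `|J|` only the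
upper bound is required: this makes the class larger, and the intervals `I` and `J` may overlap, as
they do for the maps of a commuting pair. -/
structure IsEpsteinMapWith (s a : ℝ) (g : ℝ → ℝ) (p q : ℝ) (G : Set ℂ) (F : ℂ → ℂ) : Prop
    extends IsEpsteinMap a g p q G F where
  length_comm : KCommensurable s⁻¹ a (g a - g 0)
  dist_le : setDist (Set.Icc 0 a) (Set.Icc (g 0) (g a)) ≤ s⁻¹ * (g a - g 0)
  left_space : s * (g a - g 0) ≤ g 0 - p
  right_space : s * (g a - g 0) ≤ q - g a
  deriv_end : s < derivWithin g (Set.Icc 0 a) a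

/-- The decomposition `F = Q_c ∘ h` on `G`, `Q_c(z) = z ^ 3 + c`, where `h` is univalent on `G`,
maps `G` onto the full preimage of the double-slit plane under `Q_c` (the plane with six slits),
and maps `[0,a]` onto `[0,b]`. -/
structure IsCubicDecomposition (a p q : ℝ) (G : Set ℂ) (F : ℂ → ℂ) (c : ℂ) (b : ℝ)
    (h : ℂ → ℂ) : Prop where
  b_pos : 0 < b
  analytic : AnalyticOnNhd ℂ h G
  bijOn : Set.BijOn h G {w | w ^ 3 + c ∈ slitPlaneOver (Set.Ioo p q)}
  image_interval :
    h '' ((fun x : ℝ => (x : ℂ)) '' Set.Icc 0 a) = (fun x : ℝ => (x : ℂ)) '' Set.Icc 0 b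
  eq_comp : ∀ z ∈ G, F z = h z ^ 3 + c

/-- `h` has `K`-bounded distortion on `O`. -/
def HasBoundedDistortion (K : ℝ) (h : ℂ → ℂ) (O : Set ℂ) : Prop :=
  ∀ z ∈ O, ∀ w ∈ O, ‖deriv h z‖ ≤ K * ‖deriv h w‖

/-! Everything happens in the inverse of the univalent factor. If `F = h ^ 3 + F 0` and `h` carries
`[0,1]` to `[0,b]`, then `b ^ 3 = |J|`. Since both components of `J' ∖ J` have length at least
`s|J|`, the rescaled inverse `φ u = h⁻¹(b u)` is defined and univalent on the open set `U = {u | u ^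
3 ∈ ℂ_(-s,1+s)}`, which contains `[0,1]` and depends on `s` alone. It maps `[0,1]` onto itself and
fixes `0` and `1`. Koebe estimates along a chain of disks in `U` make `φ'` comparable at all points
near `[0,1]`, and the normalization bounds `|φ'|` below on `[0,1]`. So `φ` covers a disk of fixed
radius `δ` about each point of `[0,1]`, and `O` is the `δ`-neighbourhood of `[0,1]`
(`exists_uniform_koebe_unitInterval`).

The factor exists because `0` already uses up the degree three: `F - F 0` vanishes only there, so
`(F - F 0) / z ^ 3` has a cube root on the simply connected `G` (`exists_cubeRoot`). Properness
makes the resulting `h` onto the six-slit plane, and counting fibres makes it injective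
(`bijOn_cubeRoot`). -/

open Set Metric Filter Topology

/-! ### Holomorphic roots and inverses -/

/-- A continuous branch of the `n`-th root of a nonvanishing holomorphic function is holomorphic. -/
lemma differentiableOn_of_pow_eq {f F : ℂ → ℂ} {U : Set ℂ} {n : ℕ} (hn : n ≠ 0) (hU : IsOpen U)
    (hf : ContinuousOn f U) (hF : DifferentiableOn ℂ F U) (h0 : ∀ z ∈ U, F z ≠ 0)
    (h : ∀ z ∈ U, f z ^ n = F z) : DifferentiableOn ℂ f U := by
  intro z hz
  have hfz : f z ≠ 0 := fun h1 => h0 z hz (by rw [← h z hz, h1, zero_pow hn])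
  have hne : (n : ℂ) * f z ^ (n - 1) ≠ 0 := mul_ne_zero (by exact_mod_cast hn) (pow_ne_zero _ hfz)
  have hs : HasStrictDerivAt (fun x : ℂ => x ^ n) ((n : ℂ) * f z ^ (n - 1)) (f z) :=
    hasStrictDerivAt_pow n (f z)
  have hL := hs.to_localInverse hne
  have hl := (hs.hasStrictFDerivAt_equiv hne).eventually_left_inverse
  have hc : ContinuousAt f z := hf.continuousAt (hU.mem_nhds hz)
  have hev : f =ᶠ[𝓝 z] fun x => hs.localInverse _ _ _ hne (F x) := by
    filter_upwards [hc.eventually hl, hU.mem_nhds hz] with x hx hxU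
    rw [← h x hxU]
    exact hx.symm
  refine (DifferentiableAt.congr_of_eventuallyEq ?_ hev).differentiableWithinAt
  have hd : DifferentiableAt ℂ (hs.localInverse _ _ _ hne) (F z) := by
    rw [← h z hz]; exact hL.hasDerivAt.differentiableAt
  exact hd.comp z (hF.differentiableAt (hU.mem_nhds hz))

/-- A holomorphic function with nonvanishing derivative is open. -/
lemma image_mem_nhds_of_deriv_ne_zero {f : ℂ → ℂ} {U N : Set ℂ} (hU : IsOpen U)
    (hf : DifferentiableOn ℂ f U) (hd : ∀ z ∈ U, deriv f z ≠ 0) {z : ℂ} (hz : z ∈ U)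
    (hN : N ∈ 𝓝 z) : f '' N ∈ 𝓝 (f z) := by
  have h1 : HasStrictDerivAt f (deriv f z) z :=
    (hf.analyticAt (hU.mem_nhds hz)).hasStrictDerivAt
  rw [← h1.map_nhds_eq (hd z hz)]
  exact image_mem_map hN

/-- The inverse of an injective holomorphic function with nonvanishing derivative. -/
lemma hasDerivAt_invFunOn {f : ℂ → ℂ} {U : Set ℂ} (hU : IsOpen U)
    (hf : DifferentiableOn ℂ f U) (hi : InjOn f U) (hd : ∀ z ∈ U, deriv f z ≠ 0) {z : ℂ}
    (hz : z ∈ U) : HasDerivAt (Function.invFunOn f U) (deriv f z)⁻¹ (f z) := by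
  have hinv : ∀ x ∈ U, Function.invFunOn f U (f x) = x := fun x hx => hi.leftInvOn_invFunOn hx
  have himg : f '' U ∈ 𝓝 (f z) :=
    image_mem_nhds_of_deriv_ne_zero hU hf hd hz (hU.mem_nhds hz)
  have hc : ContinuousAt (Function.invFunOn f U) (f z) := by
    rw [ContinuousAt, hinv z hz]
    intro N hN
    rw [mem_map]
    filter_upwards [image_mem_nhds_of_deriv_ne_zero hU hf hd hz
      (inter_mem hN (hU.mem_nhds hz))]
    rintro _ ⟨x, ⟨hxN, hxU⟩, rfl⟩
    simpa [hinv x hxU] using hxN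
  refine HasDerivAt.of_local_left_inverse (f := f) hc ?_ (hd z hz) ?_
  · rw [hinv z hz]
    exact (hf.differentiableAt (hU.mem_nhds hz)).hasDerivAt
  · filter_upwards [himg]
    rintro _ ⟨x, hx, rfl⟩
    rw [hinv x hx]

/-! ### Weak Koebe theorems -/

/-- A normalized univalent function on the unit disk covers no disk of radius more than one. -/
lemma radius_le_one_of_ball_subset_image {f : ℂ → ℂ} (hf : DifferentiableOn ℂ f (ball 0 1))
    (hi : InjOn f (ball 0 1)) (hd : ∀ z ∈ ball (0 : ℂ) 1, deriv f z ≠ 0) (h0 : f 0 = 0)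
    (h1 : deriv f 0 = 1) {d : ℝ} (hd0 : 0 < d) (hsub : ball 0 d ⊆ f '' ball 0 1) : d ≤ 1 := by
  have m0 : (0 : ℂ) ∈ ball (0 : ℂ) 1 := by simp
  have hψ0 : Function.invFunOn f (ball 0 1) 0 = 0 := by
    have := hi.leftInvOn_invFunOn m0
    rwa [h0] at this
  have hdψ : HasDerivAt (Function.invFunOn f (ball 0 1)) (1 : ℂ) 0 := by
    have := hasDerivAt_invFunOn isOpen_ball hf hi hd m0
    rwa [h0, h1, inv_one] at this
  have hdiff : DifferentiableOn ℂ (Function.invFunOn f (ball 0 1)) (ball 0 d) := by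
    intro w hw
    obtain ⟨z, hz, rfl⟩ := hsub hw
    exact (hasDerivAt_invFunOn isOpen_ball hf hi hd hz).differentiableAt.differentiableWithinAt
  have hmaps : MapsTo (Function.invFunOn f (ball 0 1)) (ball 0 d)
      (closedBall (Function.invFunOn f (ball 0 1) 0) 1) := by
    intro w hw
    rw [hψ0]
    exact ball_subset_closedBall (Function.invFunOn_mem (hsub hw))
  have := Complex.norm_deriv_le_div_of_mapsTo_ball hdiff hmaps hd0
  rw [hdψ.deriv, norm_one, le_div_iff₀ hd0] at this
  linarith

/-- A weak form of Koebe's theorems for normalized univalent functions. -/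
lemma koebe_normalized {f : ℂ → ℂ} (hf : DifferentiableOn ℂ f (ball 0 1))
    (hi : InjOn f (ball 0 1)) (hd : ∀ z ∈ ball (0 : ℂ) 1, deriv f z ≠ 0) (h0 : f 0 = 0)
    (h1 : deriv f 0 = 1) :
    ball 0 (1 / 312) ⊆ f '' ball 0 1 ∧ ∀ z ∈ ball (0 : ℂ) (1 / 12), ‖f z‖ ≤ 26 := by
  have m0 : (0 : ℂ) ∈ ball (0 : ℂ) 1 := by simp
  have hopen : IsOpen (f '' ball 0 1) := by
    rw [isOpen_iff_mem_nhds]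
    rintro _ ⟨z, hz, rfl⟩
    exact image_mem_nhds_of_deriv_ne_zero isOpen_ball hf hd hz (isOpen_ball.mem_nhds hz)
  have hne : ((f '' ball 0 1)ᶜ).Nonempty := by
    rw [nonempty_compl]
    intro h
    have := radius_le_one_of_ball_subset_image hf hi hd h0 h1 (d := 2) (by norm_num)
      (by rw [h]; exact subset_univ _)
    norm_num at this
  obtain ⟨w₀, hw₀, hdist⟩ := hopen.isClosed_compl.exists_infDist_eq_dist hne 0
  have hw₀0 : w₀ ≠ 0 := fun h => hw₀ ⟨0, m0, by rw [h0, h]⟩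
  have hwpos : 0 < ‖w₀‖ := norm_pos_iff.2 hw₀0
  have hsub : ball 0 ‖w₀‖ ⊆ f '' ball 0 1 := by
    intro w hw
    by_contra hcon
    have := infDist_le_dist_of_mem (x := (0 : ℂ)) (mem_compl hcon)
    rw [hdist, dist_zero_left, dist_zero_left] at this
    rw [mem_ball_zero_iff] at hw
    linarith
  have hw1 : ‖w₀‖ ≤ 1 := radius_le_one_of_ball_subset_image hf hi hd h0 h1 hwpos hsub
  have hnz : ∀ z ∈ ball (0 : ℂ) 1, 1 - f z / w₀ ≠ 0 := by
    intro z hz h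
    refine hw₀ ⟨z, hz, ?_⟩
    field_simp at h
    linear_combination -h
  have hFd : DifferentiableOn ℂ (fun z => 1 - f z / w₀) (ball 0 1) :=
    (differentiableOn_const _).sub (hf.div_const _)
  have hsc : IsSimplyConnected (ball (0 : ℂ) 1) :=
    have := (convex_ball (0 : ℂ) 1).contractibleSpace ⟨0, m0⟩
    SimplyConnectedSpace.ofContractible _
  obtain ⟨g₀, hg₀c, hg₀⟩ := Complex.exists_continuousOn_pow_eq hsc isOpen_ball
    hFd.continuousOn (by rintro ⟨z, hz, h⟩; exact hnz z hz h) two_ne_zero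
  obtain ⟨g, hgc, hg, hg1⟩ : ∃ g : ℂ → ℂ, ContinuousOn g (ball 0 1) ∧
      (∀ z, g z ^ 2 = 1 - f z / w₀) ∧ g 0 = 1 := by
    have := hg₀ 0
    rw [h0, zero_div, sub_zero, sq_eq_one_iff] at this
    rcases this with h | h
    · exact ⟨g₀, hg₀c, hg₀, h⟩
    · exact ⟨fun z => - g₀ z, hg₀c.neg, fun z => by rw [neg_sq, hg₀], by simp [h]⟩
  have hgd : DifferentiableOn ℂ g (ball 0 1) :=
    differentiableOn_of_pow_eq two_ne_zero isOpen_ball hgc hFd hnz (fun z _ => hg z)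
  have hfg : ∀ z, f z = w₀ * (1 - g z ^ 2) := by
    intro z
    rw [hg]
    field_simp
    ring
  -- the branch has positive real part over the disk of radius `‖w₀‖`
  have hpos : ∀ w ∈ ball (0 : ℂ) ‖w₀‖, 0 < (g (Function.invFunOn f (ball 0 1) w)).re := by
    have hcont : ContinuousOn (fun w => (g (Function.invFunOn f (ball 0 1) w)).re)
        (ball 0 ‖w₀‖) := by
      refine Complex.continuous_re.comp_continuousOn (hgc.comp ?_ ?_)
      · intro w hw
        obtain ⟨z, hz, rfl⟩ := hsub hw
        exact (hasDerivAt_invFunOn isOpen_ball hf hi hd hz).continuousAt.continuousWithinAt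
      · intro w hw
        exact Function.invFunOn_mem (hsub hw)
    -- If `Re g = 0` then `g ^ 2` is real and nonpositive, whereas `1 - w / w₀` has positive real
    -- part.
    have hne0 : ∀ w ∈ ball (0 : ℂ) ‖w₀‖, (g (Function.invFunOn f (ball 0 1) w)).re ≠ 0 := by
      intro w hw h
      have h2 := hg (Function.invFunOn f (ball 0 1) w)
      rw [Function.invFunOn_eq (hsub hw)] at h2
      have h3 : ‖w / w₀‖ < 1 := by
        rw [norm_div, div_lt_one hwpos]; simpa using hw
      have h4 := congrArg Complex.re h2
      rw [sq, Complex.mul_re, h, Complex.sub_re, Complex.one_re] at h4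
      nlinarith [Complex.re_le_norm (w / w₀),
        mul_self_nonneg (g (Function.invFunOn f (ball 0 1) w)).im]
    have hψ0 : Function.invFunOn f (ball 0 1) 0 = 0 := by
      have := hi.leftInvOn_invFunOn m0
      rwa [h0] at this
    intro w hw
    by_contra hcon
    obtain ⟨v, hv, hv0⟩ := (convex_ball (0 : ℂ) ‖w₀‖).isPreconnected.intermediate_value hw
      (mem_ball_self hwpos) hcont
      (show (0 : ℝ) ∈ Icc _ _ from ⟨not_lt.1 hcon, by simp [hψ0, hg1]⟩)
    exact hne0 v hv hv0
  -- Near `-1` the value `f z = w₀ (1 - g z ^ 2)` falls in the disk of radius `‖w₀‖`, since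
  -- `(2/5)(12/5) < 1`. There injectivity of `f` forces the branch with positive real part, which is
  -- far from `-1`.
  have homit : ∀ z ∈ ball (0 : ℂ) 1, 2 / 5 ≤ ‖g z + 1‖ := by
    intro z hz
    by_contra! hlt
    have h3 : ‖f z‖ < ‖w₀‖ := by
      have e : f z = w₀ * ((g z + 1) * (2 - (g z + 1))) := by rw [hfg z]; ring
      have h5 : ‖2 - (g z + 1)‖ ≤ 2 + 2 / 5 := by
        refine (norm_sub_le _ _).trans ?_
        rw [Complex.norm_ofNat]
        linarith
      have h6 : ‖g z + 1‖ * ‖2 - (g z + 1)‖ < 1 := by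
        nlinarith [norm_nonneg (g z + 1), norm_nonneg (2 - (g z + 1))]
      rw [e, norm_mul, norm_mul]
      nlinarith
    have h4 := hpos (f z) (by simpa using h3)
    rw [hi.leftInvOn_invFunOn hz] at h4
    have h5 := Complex.re_le_norm (g z + 1)
    rw [Complex.add_re, Complex.one_re] at h5
    linarith
  have hgne : ∀ z ∈ ball (0 : ℂ) 1, g z + 1 ≠ 0 := by
    intro z hz h
    have := homit z hz
    rw [h, norm_zero] at this
    norm_num at this
  have hmd : DifferentiableOn ℂ (fun z => (g z + 1)⁻¹) (ball 0 1) :=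
    (hgd.add_const 1).inv hgne
  have hm0 : (g 0 + 1)⁻¹ = 1 / 2 := by rw [hg1]; norm_num
  have hmaps : MapsTo (fun z => (g z + 1)⁻¹) (ball 0 1)
      (closedBall ((fun z => (g z + 1)⁻¹) 0) 3) := by
    intro z hz
    simp only [mem_closedBall, hm0]
    rw [dist_eq_norm]
    refine (norm_sub_le _ _).trans ?_
    have : ‖(g z + 1)⁻¹‖ ≤ 5 / 2 := by
      rw [norm_inv]
      have := inv_anti₀ (by norm_num) (homit z hz)
      linarith [show ((2 : ℝ) / 5)⁻¹ = 5 / 2 by norm_num]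
    have h2 : ‖(1 / 2 : ℂ)‖ = 1 / 2 := by simp
    linarith
  -- By Schwarz, `1 / (g + 1)` moves by at most `3/12` from `1/2`; hence `‖g + 1‖ ≤ 4`, `‖g‖ ≤ 5`
  -- and `‖1 - g ^ 2‖ ≤ 26`.
  have hbound : ∀ z ∈ ball (0 : ℂ) (1 / 12), ‖f z‖ ≤ 26 * ‖w₀‖ := by
    intro z hz
    have hz1 : z ∈ ball (0 : ℂ) 1 := ball_subset_ball (by norm_num) hz
    have h2 := Complex.dist_le_div_mul_dist_of_mapsTo_ball hmd hmaps hz1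
    simp only [hm0] at h2
    rw [dist_zero_right, dist_eq_norm] at h2
    rw [mem_ball_zero_iff] at hz
    have h3 : ‖(1 / 2 : ℂ)‖ - ‖(1 / 2 : ℂ) - (g z + 1)⁻¹‖ ≤ ‖(g z + 1)⁻¹‖ := by
      have := norm_sub_norm_le (1 / 2 : ℂ) ((1 / 2 : ℂ) - (g z + 1)⁻¹)
      simpa using this
    rw [norm_sub_rev] at h3
    have h4 : ‖(1 / 2 : ℂ)‖ = 1 / 2 := by simp
    have h5 : 1 / 4 ≤ ‖g z + 1‖⁻¹ := by rw [← norm_inv]; linarith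
    have h6 : ‖g z + 1‖ ≤ 4 := by
      have := inv_anti₀ (by norm_num) h5
      rw [inv_inv] at this
      linarith [show ((1 : ℝ) / 4)⁻¹ = 4 by norm_num]
    have h7 : ‖g z‖ ≤ 5 := by
      have := norm_sub_le (g z + 1) 1
      rw [add_sub_cancel_right, norm_one] at this
      linarith
    have h8 : ‖1 - g z ^ 2‖ ≤ 26 := by
      refine (norm_sub_le _ _).trans ?_
      rw [norm_one, norm_pow]
      nlinarith [norm_nonneg (g z)]
    rw [hfg z, norm_mul]
    nlinarith
  refine ⟨?_, fun z hz => (hbound z hz).trans (by linarith)⟩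
  -- The bound on the disk of radius `1/12` gives `1 ≤ 12 · 26 ‖w₀‖ = 312 ‖w₀‖`.
  have h2 : ‖deriv f 0‖ ≤ 26 * ‖w₀‖ / (1 / 12) := by
    refine Complex.norm_deriv_le_div_of_mapsTo_ball
      (hf.mono (ball_subset_ball (by norm_num))) ?_ (by norm_num)
    intro z hz
    simpa [h0] using hbound z hz
  rw [h1, norm_one] at h2
  refine (ball_subset_ball ?_).trans hsub
  linarith

/-- A weak form of Koebe's covering and distortion theorems on a disk. -/
lemma koebe_ball {f : ℂ → ℂ} {z₀ : ℂ} {R : ℝ} (hR : 0 < R)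
    (hf : DifferentiableOn ℂ f (ball z₀ R))
    (hi : InjOn f (ball z₀ R)) (hd : ∀ z ∈ ball z₀ R, deriv f z ≠ 0) :
    ball (f z₀) (‖deriv f z₀‖ * R / 312) ⊆ f '' ball z₀ R ∧
      ∀ z ∈ ball z₀ (R / 24), ‖deriv f z‖ ≤ 1248 * ‖deriv f z₀‖ := by
  have hRC : (R : ℂ) ≠ 0 := by exact_mod_cast hR.ne'
  have hD : deriv f z₀ ≠ 0 := hd z₀ (mem_ball_self hR)
  have hDp : 0 < ‖deriv f z₀‖ := norm_pos_iff.2 hD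
  set F : ℂ → ℂ := fun u => (f (z₀ + R * u) - f z₀) / (R * deriv f z₀) with hFdef
  have hm : ∀ (t : ℝ) (u : ℂ), u ∈ ball (0 : ℂ) t ↔ z₀ + R * u ∈ ball z₀ (R * t) := by
    intro t u
    rw [mem_ball_zero_iff, mem_ball_iff_norm, add_sub_cancel_left, norm_mul, Complex.norm_real,
      Real.norm_of_nonneg hR.le, mul_lt_mul_iff_right₀ hR]
  have hm1 : ∀ u ∈ ball (0 : ℂ) 1, z₀ + R * u ∈ ball z₀ R := by
    intro u hu; simpa using (hm 1 u).1 hu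
  have hder : ∀ u ∈ ball (0 : ℂ) 1,
      HasDerivAt F (deriv f (z₀ + R * u) / deriv f z₀) u := by
    intro u hu
    have h2 : HasDerivAt f (deriv f (z₀ + R * u)) (z₀ + R * u) :=
      (hf.differentiableAt (isOpen_ball.mem_nhds (hm1 u hu))).hasDerivAt
    have h3 : HasDerivAt (fun u : ℂ => z₀ + R * u) (R : ℂ) u := by
      simpa using ((hasDerivAt_id u).const_mul (R : ℂ)).const_add z₀
    have h4 := ((h2.comp u h3).sub_const (f z₀)).div_const (R * deriv f z₀)
    refine h4.congr_deriv ?_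
    field_simp
  obtain ⟨hcov, hbd⟩ := koebe_normalized (f := F)
    (fun u hu => (hder u hu).differentiableAt.differentiableWithinAt)
    (by
      intro u hu v hv huv
      simp only [hFdef] at huv
      have h2 : f (z₀ + R * u) = f (z₀ + R * v) := by
        field_simp at huv
        linear_combination huv
      have h3 := hi (hm1 u hu) (hm1 v hv) h2
      have h4 : (R : ℂ) * u = R * v := by linear_combination h3
      exact mul_left_cancel₀ hRC h4)
    (fun u hu => by
      rw [(hder u hu).deriv]
      exact div_ne_zero (hd _ (hm1 u hu)) hD)
    (by simp [hFdef])
    (by rw [(hder 0 (by simp)).deriv]; simp [hD])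
  constructor
  · intro w hw
    have h2 : (w - f z₀) / (R * deriv f z₀) ∈ ball (0 : ℂ) (1 / 312) := by
      rw [mem_ball_iff_norm] at hw
      rw [mem_ball_zero_iff, norm_div, norm_mul, Complex.norm_real, Real.norm_of_nonneg hR.le,
        div_lt_iff₀ (by positivity)]
      linarith
    obtain ⟨u, hu, huw⟩ := hcov h2
    refine ⟨z₀ + R * u, hm1 u hu, ?_⟩
    simp only [hFdef] at huw
    field_simp at huw
    linear_combination huw
  · intro z hz
    set u : ℂ := (z - z₀) / R with hu
    have hzu : z₀ + R * u = z := by rw [hu]; field_simp; ring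
    have huz : u ∈ ball (0 : ℂ) (1 / 24) := by
      rw [hm, hzu]; convert hz using 2; ring
    have hsub : ball u (1 / 24) ⊆ ball (0 : ℂ) (1 / 12) := by
      refine ball_subset_ball' ?_
      have := mem_ball.1 huz
      linarith
    have h12 : ball (0 : ℂ) (1 / 12) ⊆ ball 0 1 := ball_subset_ball (by norm_num)
    have hu1 : u ∈ ball (0 : ℂ) 1 := h12 (hsub (mem_ball_self (by norm_num)))
    -- `F` varies by at most `26 + 26` around `u`, and `52 · 24 = 1248`.
    have h2 : ‖deriv F u‖ ≤ 52 / (1 / 24) := by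
      refine Complex.norm_deriv_le_div_of_mapsTo_ball (fun v hv =>
        (hder v (h12 (hsub hv))).differentiableAt.differentiableWithinAt) ?_ (by norm_num)
      intro v hv
      rw [mem_closedBall, dist_eq_norm]
      refine (norm_sub_le _ _).trans ?_
      linarith [hbd v (hsub hv), hbd u (hsub (mem_ball_self (by norm_num)))]
    rw [(hder u hu1).deriv, hzu, norm_div, div_le_iff₀ hDp] at h2
    linarith

/-! ### Uniform Koebe bounds along the unit interval -/

/-- Univalent functions `φ` on a neighbourhood of `[0,1]` with `φ 0 = 0` and `φ 1 = 1` cover uniform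
disks about the points `φ x`, on which the inverse has bounded distortion. -/
lemma exists_uniform_koebe_unitInterval {U : Set ℂ} (hU : IsOpen U)
    (hIU : ∀ x ∈ Icc (0 : ℝ) 1, (x : ℂ) ∈ U) :
    ∃ δ > 0, ∃ K : ℝ, 0 < K ∧ ∀ φ : ℂ → ℂ, DifferentiableOn ℂ φ U → InjOn φ U →
      (∀ z ∈ U, deriv φ z ≠ 0) → φ 0 = 0 → φ 1 = 1 →
      ∃ S ⊆ U, (∀ x ∈ Icc (0 : ℝ) 1, ball (φ x) δ ⊆ φ '' S) ∧
        ∀ u ∈ S, ∀ v ∈ S, ‖deriv φ u‖ ≤ K * ‖deriv φ v‖ := by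
  have hcomp : IsCompact ((fun x : ℝ => (x : ℂ)) '' Icc 0 1) :=
    isCompact_Icc.image Complex.continuous_ofReal
  obtain ⟨r, hr, hrU⟩ := hcomp.exists_thickening_subset_open hU
    (by rintro _ ⟨x, hx, rfl⟩; exact hIU x hx)
  have hball : ∀ x ∈ Icc (0 : ℝ) 1, ball (x : ℂ) r ⊆ U := fun x hx =>
    (ball_subset_thickening (mem_image_of_mem (fun x : ℝ => (x : ℂ)) hx) r).trans hrU
  set N : ℕ := ⌈48 * 2 / r⌉₊ with hN
  have hNr : 1 ≤ N * (r / 96) := by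
    have := Nat.le_ceil (48 * 2 / r)
    rw [← hN, div_le_iff₀ hr] at this
    linarith
  have hC : (0 : ℝ) < 1248 ^ N := by positivity
  -- `δ` is the Koebe covering radius for disks of radius `r / 48` with `‖φ'‖ ≥ (1248 ^ N)⁻¹` at the
  -- centre. `K` pays for a chain of `N` steps in `[0,1]` and one local comparison at each end.
  refine ⟨(1248 ^ N)⁻¹ * (r / 48) / 312, by positivity, 1248 * 1248 ^ N * 1248, by positivity, ?_⟩
  intro φ hφ hinj hder h0 h1
  have hloc : ∀ x ∈ Icc (0 : ℝ) 1, ∀ u ∈ ball (x : ℂ) (r / 48),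
      ‖deriv φ u‖ ≤ 1248 * ‖deriv φ x‖ ∧ ‖deriv φ x‖ ≤ 1248 * ‖deriv φ u‖ := by
    intro x hx u hu
    have hb := hball x hx
    constructor
    · exact (koebe_ball hr (hφ.mono hb) (hinj.mono hb) (fun z hz => hder z (hb hz))).2 u
        (ball_subset_ball (by linarith) hu)
    · have hb' : ball u (r / 2) ⊆ U := by
        refine (ball_subset_ball' ?_).trans hb
        have := mem_ball.1 hu
        linarith
      refine (koebe_ball (half_pos hr) (hφ.mono hb') (hinj.mono hb')
        (fun z hz => hder z (hb' hz))).2 x ?_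
      rw [mem_ball_comm]
      convert hu using 2
      ring
  have hchain : ∀ n : ℕ, ∀ x ∈ Icc (0 : ℝ) 1, ∀ y ∈ Icc (0 : ℝ) 1, |x - y| ≤ n * (r / 96) →
      ‖deriv φ x‖ ≤ 1248 ^ n * ‖deriv φ y‖ := by
    intro n
    induction n with
    | zero =>
      intro x _ y _ hxy
      have : x = y := by
        have h2 : |x - y| ≤ 0 := by simpa using hxy
        linarith [abs_nonpos_iff.1 h2]
      simp [this]
    | succ n ih =>
      intro x hx y hy hxy
      have hn : (0 : ℝ) < n + 1 := by positivity
      set t : ℝ := x + (y - x) / (n + 1) with ht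
      have e1 : x - t = (x - y) * (1 / (n + 1)) := by rw [ht]; ring
      have e2 : t - y = (x - y) * (n / (n + 1)) := by rw [ht]; field_simp; ring
      have htI : t ∈ Icc (0 : ℝ) 1 := by
        have : t = (n / (n + 1)) * x + (1 / (n + 1)) * y := by rw [ht]; field_simp; ring
        rw [this]
        exact (convex_Icc (0 : ℝ) 1) hx hy (a := (n : ℝ) / (n + 1)) (b := 1 / ((n : ℝ) + 1))
          (by positivity) (by positivity) (by rw [← add_div, div_self hn.ne'])
      push_cast at hxy
      have a1 : |x - t| ≤ r / 96 := by
        rw [e1, abs_mul, abs_of_nonneg (a := 1 / ((n : ℝ) + 1)) (by positivity), mul_one_div,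
          div_le_iff₀ hn]
        linarith
      have a2 : |t - y| ≤ n * (r / 96) := by
        rw [e2, abs_mul, abs_of_nonneg (a := (n : ℝ) / (n + 1)) (by positivity), ← mul_div_assoc,
          div_le_iff₀ hn]
        nlinarith
      have h2 := ih t htI y hy a2
      have h3 := (hloc t htI x (by
        rw [mem_ball, dist_eq_norm, ← Complex.ofReal_sub, Complex.norm_real, Real.norm_eq_abs]
        linarith)).1
      calc ‖deriv φ x‖ ≤ 1248 * ‖deriv φ t‖ := h3
        _ ≤ 1248 * (1248 ^ n * ‖deriv φ y‖) := by gcongr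
        _ = 1248 ^ (n + 1) * ‖deriv φ y‖ := by ring
  have hcomp2 : ∀ x ∈ Icc (0 : ℝ) 1, ∀ y ∈ Icc (0 : ℝ) 1,
      ‖deriv φ x‖ ≤ 1248 ^ N * ‖deriv φ y‖ := by
    intro x hx y hy
    refine hchain N x hx y hy (le_trans ?_ hNr)
    rw [abs_le]
    constructor <;> linarith [hx.1, hx.2, hy.1, hy.2]
  have hlow : ∀ y ∈ Icc (0 : ℝ) 1, (1248 ^ N)⁻¹ ≤ ‖deriv φ y‖ := by
    intro y hy
    -- The mean value inequality: `1 = ‖φ 1 - φ 0‖` is at most the supremum of `‖φ'‖` on `[0,1]`.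
    have := norm_image_sub_le_of_norm_deriv_le_segment_01' (f := fun x : ℝ => φ x)
      (f' := fun x : ℝ => deriv φ x) (C := 1248 ^ N * ‖deriv φ y‖)
      (fun x hx => ((hφ.differentiableAt
        (hU.mem_nhds (hIU x hx))).hasDerivAt.comp_ofReal).hasDerivWithinAt)
      (fun x hx => hcomp2 x ⟨hx.1, hx.2.le⟩ y hy)
    simp only [Complex.ofReal_one, Complex.ofReal_zero, h0, h1, sub_zero, norm_one] at this
    rw [inv_le_iff_one_le_mul₀ hC]
    linarith
  refine ⟨⋃ x ∈ Icc (0 : ℝ) 1, ball (x : ℂ) (r / 48), ?_, ?_, ?_⟩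
  · exact iUnion₂_subset fun x hx => (ball_subset_ball (by linarith)).trans (hball x hx)
  · intro x hx
    have hb : ball (x : ℂ) (r / 48) ⊆ U := (ball_subset_ball (by linarith)).trans (hball x hx)
    have h2 := (koebe_ball (by linarith : (0 : ℝ) < r / 48) (hφ.mono hb) (hinj.mono hb)
      (fun z hz => hder z (hb hz))).1
    refine (ball_subset_ball ?_).trans (h2.trans (image_mono (subset_iUnion₂ (s := fun (x : ℝ)
      (_ : x ∈ Icc (0 : ℝ) 1) => ball (x : ℂ) (r / 48)) x hx)))
    have := hlow x hx
    gcongr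
  · intro u hu v hv
    obtain ⟨x, hx, hux⟩ := mem_iUnion₂.1 hu
    obtain ⟨y, hy, hvy⟩ := mem_iUnion₂.1 hv
    calc ‖deriv φ u‖ ≤ 1248 * ‖deriv φ x‖ := (hloc x hx u hux).1
      _ ≤ 1248 * (1248 ^ N * ‖deriv φ y‖) := by gcongr; exact hcomp2 x hx y hy
      _ ≤ 1248 * (1248 ^ N * (1248 * ‖deriv φ v‖)) := by gcongr; exact (hloc y hy v hvy).2
      _ = 1248 * 1248 ^ N * 1248 * ‖deriv φ v‖ := by ring

/-! ### Fibres of an Epstein map -/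

lemma isOpen_slitPlaneOver {T : Set ℝ} (hT : IsOpen T) : IsOpen (slitPlaneOver T) :=
  (isOpen_ne_fun Complex.continuous_im continuous_const).union (hT.preimage Complex.continuous_re)

lemma IsTopologicalDisk.isSimplyConnected {G : Set ℂ} (hG : IsTopologicalDisk G) :
    IsSimplyConnected G := by
  obtain ⟨e⟩ := hG.homeo
  have : ContractibleSpace (ball (0 : ℂ) 1) :=
    (convex_ball (0 : ℂ) 1).contractibleSpace ⟨0, by simp⟩
  have : ContractibleSpace G := e.contractibleSpace
  exact SimplyConnectedSpace.ofContractible _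

namespace IsEpsteinMap

variable {a p q : ℝ} {g : ℝ → ℝ} {G : Set ℂ} {F : ℂ → ℂ}

lemma zero_mem (H : IsEpsteinMap a g p q G F) : (0 : ℂ) ∈ G := by
  simpa using H.interval_subset 0 ⟨le_rfl, H.a_pos.le⟩

lemma apply_zero (H : IsEpsteinMap a g p q G F) : F 0 = g 0 := by
  simpa using H.extends_map 0 ⟨le_rfl, H.a_pos.le⟩

lemma lt_of_pos (H : IsEpsteinMap a g p q G F) {x : ℝ} (hx : x ∈ Ioc 0 a) : g 0 < g x :=
  H.strictMonoOn ⟨le_rfl, H.a_pos.le⟩ ⟨hx.1.le, hx.2⟩ hx.1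

lemma zero_mem_Ioo (H : IsEpsteinMap a g p q G F) : g 0 ∈ Ioo p q :=
  H.subset_slit ⟨le_rfl, (H.lt_of_pos ⟨H.a_pos, le_rfl⟩).le⟩

lemma isOpen (H : IsEpsteinMap a g p q G F) : IsOpen G := H.disk.isOpen

lemma analyticOrderNatAt_zero (H : IsEpsteinMap a g p q G F) :
    analyticOrderNatAt (fun ζ => F ζ - F 0) 0 = 3 := by
  rw [analyticOrderNatAt, H.branch_zero]; rfl

lemma analyticOrderNatAt_of_ne (H : IsEpsteinMap a g p q G F) {z : ℂ} (hz : z ∈ G) (h0 : z ≠ 0) :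
    analyticOrderNatAt (fun ζ => F ζ - F z) z = 1 := by
  rw [analyticOrderNatAt, (H.cover.analytic z hz).analyticOrderAt_sub_eq_one_of_deriv_ne_zero
    (H.branch_only z hz h0)]
  rfl

/-- The critical point is the only preimage of the critical value. -/
lemma eq_zero_of_apply_eq (H : IsEpsteinMap a g p q G F) {z : ℂ} (hz : z ∈ G) (hF : F z = F 0) :
    z = 0 := by
  by_contra h0
  set φ : ℂ → ℕ := fun z => analyticOrderNatAt (fun ζ => F ζ - F 0) z with hφ
  have hdeg := H.cover.degree (F 0) (H.cover.mapsTo H.zero_mem)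
  have hfin : (G ∩ F ⁻¹' {F 0} ∩ Function.support φ).Finite := by
    -- Over an infinite support `finsum` takes the default value `0`, which is not the degree.
    by_contra hinf
    rw [finsum_mem_eq_zero_of_infinite hinf] at hdeg
    norm_num at hdeg
  have hz1 : φ z = 1 := by
    have := H.analyticOrderNatAt_of_ne hz h0
    rwa [hF] at this
  have h01 : φ 0 = 3 := H.analyticOrderNatAt_zero
  have hsub : ({0, z} : Set ℂ) ⊆ G ∩ F ⁻¹' {F 0} ∩ Function.support φ := by
    rintro x (rfl | rfl)
    · exact ⟨⟨H.zero_mem, rfl⟩, by simp [h01]⟩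
    · exact ⟨⟨hz, hF⟩, by simp [hz1]⟩
  rw [finsum_mem_eq_sum_of_inter_support_eq φ (t := hfin.toFinset)
    (by rw [hfin.coe_toFinset, inter_assoc _ (Function.support φ), inter_self])] at hdeg
  have h2 : ∑ x ∈ ({0, z} : Finset ℂ), φ x ≤ ∑ x ∈ hfin.toFinset, φ x :=
    Finset.sum_le_sum_of_subset fun x hx => hfin.mem_toFinset.2 (hsub (by simpa using hx))
  rw [Finset.sum_pair (Ne.symm h0), h01, hz1] at h2
  omega

/-- Off the critical value all multiplicities are one, so the degree counts points. -/
lemma ncard_fibre (H : IsEpsteinMap a g p q G F) {w : ℂ} (hw : w ∈ slitPlaneOver (Ioo p q))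
    (hne : w ≠ F 0) : (G ∩ F ⁻¹' {w}).ncard = 3 := by
  have hone : ∀ z ∈ G ∩ F ⁻¹' {w}, analyticOrderNatAt (fun ζ => F ζ - w) z = 1 := by
    rintro z ⟨hz, rfl⟩
    exact H.analyticOrderNatAt_of_ne hz (by rintro rfl; exact hne rfl)
  have hdeg := H.cover.degree w hw
  rw [finsum_mem_congr rfl hone] at hdeg
  have hfin : (G ∩ F ⁻¹' {w}).Finite := by
    by_contra hinf
    rw [finsum_mem_eq_zero_of_infinite (by
      rwa [Function.support_const one_ne_zero, inter_univ])] at hdeg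
    norm_num at hdeg
  rw [finsum_mem_eq_finite_toFinset_sum _ hfin, Finset.sum_const, smul_eq_mul, mul_one] at hdeg
  rw [ncard_eq_toFinset_card _ hfin, hdeg]

/-! ### The cube root as a conformal map -/

/-- A holomorphic cube root of `F - F 0` has nonvanishing derivative. -/
lemma deriv_ne_zero (H : IsEpsteinMap a g p q G F) {h : ℂ → ℂ} (ha : AnalyticOnNhd ℂ h G)
    (h0 : h 0 = 0) (hF : ∀ z ∈ G, F z = h z ^ 3 + F 0) {z : ℂ} (hz : z ∈ G) :
    deriv h z ≠ 0 := by
  have hev : ∀ x ∈ G, F =ᶠ[𝓝 x] fun z => h z ^ 3 + F 0 := fun x hx => by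
    filter_upwards [H.isOpen.mem_nhds hx] with y hy using hF y hy
  by_cases hz0 : z = 0
  · subst hz0
    -- Cubing triples the order of vanishing, so `h` has a simple zero at `0`.
    have h1 : analyticOrderAt (h ^ 3) 0 = 3 := by
      rw [← H.branch_zero]
      refine analyticOrderAt_congr ?_
      filter_upwards [hev 0 hz] with y hy
      rw [hy]; simp
    rw [analyticOrderAt_pow (ha 0 hz)] at h1
    have h2 := (ha 0 hz).analyticOrderAt_deriv_add_one
    simp only [h0, sub_zero] at h2
    have h3 : analyticOrderAt h 0 = 1 := by
      generalize analyticOrderAt h 0 = n at h1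
      induction n using ENat.recTopCoe with
      | top => simp at h1
      | coe n =>
        have h1' : ((3 * n : ℕ) : ℕ∞) = ((3 : ℕ) : ℕ∞) := by simpa using h1
        have : 3 * n = 3 := by exact_mod_cast h1'
        have : n = 1 := by omega
        simp [this]
    intro hd
    have h4 : analyticOrderAt (deriv h) 0 ≠ 0 :=
      analyticOrderAt_ne_zero.2 ⟨(ha 0 hz).deriv, hd⟩
    rw [show (fun x => h x) = h from rfl, h3] at h2
    generalize analyticOrderAt (deriv h) 0 = n at h2 h4
    induction n using ENat.recTopCoe with
    | top => simp at h2
    | coe n =>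
      have : n + 1 = 1 := by exact_mod_cast h2
      exact h4 (by simp; omega)
  · intro hd
    refine H.branch_only z hz hz0 ?_
    rw [(hev z hz).deriv_eq]
    have := (((ha z hz).differentiableAt.hasDerivAt.pow 3).add_const (F 0)).deriv
    simpa [hd] using this

/-- `F - F 0` has a holomorphic cube root. -/
lemma exists_cubeRoot (H : IsEpsteinMap a g p q G F) :
    ∃ h : ℂ → ℂ, AnalyticOnNhd ℂ h G ∧ ∀ z ∈ G, F z = h z ^ 3 + F 0 := by
  have hFa := H.cover.analytic
  obtain ⟨k₀, hk₀a, hk₀0, hk₀⟩ :=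
    (((hFa 0 H.zero_mem).sub analyticAt_const).analyticOrderAt_eq_natCast (n := 3)).1 (by exact_mod_cast H.branch_zero)
  -- `(F - F 0) / z ^ 3` with its removable singularity filled in.
  set k : ℂ → ℂ := fun z => if z = 0 then k₀ 0 else (F z - F 0) / z ^ 3 with hk
  have hkk : k =ᶠ[𝓝 0] k₀ := by
    filter_upwards [hk₀] with z hz
    by_cases h : z = 0
    · simp [hk, h]
    · simp only [hk, h, if_false]
      have hz' : F z - F 0 = z ^ 3 * k₀ z := by simpa using hz
      rw [hz']
      field_simp
  have hkd : DifferentiableOn ℂ k G := by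
    intro z hz
    refine DifferentiableAt.differentiableWithinAt ?_
    by_cases h : z = 0
    · subst h
      exact hk₀a.differentiableAt.congr_of_eventuallyEq hkk
    · have hev : k =ᶠ[𝓝 z] fun z => (F z - F 0) / z ^ 3 := by
        filter_upwards [isOpen_ne.mem_nhds h] with y hy
        simp only [hk, if_neg hy]
      refine DifferentiableAt.congr_of_eventuallyEq ?_ hev
      exact ((hFa z hz).differentiableAt.sub_const _).div (by fun_prop) (pow_ne_zero _ h)
  have hkne : ∀ z ∈ G, k z ≠ 0 := by
    intro z hz
    by_cases h : z = 0
    · simpa [hk, h] using hk₀0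
    · simp only [hk, if_neg h]
      exact div_ne_zero (sub_ne_zero.2 fun h2 => h (H.eq_zero_of_apply_eq hz h2)) (pow_ne_zero _ h)
  obtain ⟨κ, hκc, hκ⟩ := Complex.exists_continuousOn_pow_eq H.disk.isSimplyConnected H.isOpen
    hkd.continuousOn (by rintro ⟨z, hz, h⟩; exact hkne z hz h) three_ne_zero
  have hκd := differentiableOn_of_pow_eq three_ne_zero H.isOpen hκc hkd hkne (fun z _ => hκ z)
  refine ⟨fun z => z * κ z, (differentiableOn_id.mul hκd).analyticOnNhd H.isOpen, ?_⟩
  intro z hz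
  simp only [mul_pow, hκ]
  by_cases h : z = 0
  · simp [h]
  · simp only [hk, if_neg h]
    field_simp
    ring

/-- A holomorphic cube root of `F - F 0` maps `G` bijectively onto the plane with six slits. -/
lemma bijOn_cubeRoot (H : IsEpsteinMap a g p q G F) {h : ℂ → ℂ} (ha : AnalyticOnNhd ℂ h G)
    (hF : ∀ z ∈ G, F z = h z ^ 3 + F 0) :
    BijOn h G {w | w ^ 3 + F 0 ∈ slitPlaneOver (Ioo p q)} := by
  set W : Set ℂ := {w | w ^ 3 + F 0 ∈ slitPlaneOver (Ioo p q)} with hW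
  have h0 : h 0 = 0 := by
    have := hF 0 H.zero_mem
    exact pow_eq_zero_iff three_ne_zero |>.1 (by linear_combination -this)
  have hd : ∀ z ∈ G, deriv h z ≠ 0 := fun z hz => H.deriv_ne_zero ha h0 hF hz
  have hmaps : MapsTo h G W := fun z hz => by
    change h z ^ 3 + F 0 ∈ slitPlaneOver (Ioo p q)
    rw [← hF z hz]; exact H.cover.mapsTo hz
  have hWo : IsOpen W :=
    (isOpen_slitPlaneOver isOpen_Ioo).preimage (by fun_prop : Continuous fun w : ℂ => w ^ 3 + F 0)
  -- Scaling `w` by `t` scales `w ^ 3` by `t ^ 3`, and the double-slit plane is star-shaped about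
  -- the critical value.
  have hstar : StarConvex ℝ 0 W := by
    rw [starConvex_zero_iff]
    intro w hw t ht0 ht1
    have e : (t • w) ^ 3 = ((t ^ 3 : ℝ) : ℂ) * w ^ 3 := by
      rw [Complex.real_smul, mul_pow]; push_cast; ring
    have hI := H.zero_mem_Ioo
    simp only [hW, mem_ofPred_eq, e, H.apply_zero] at hw ⊢
    simp only [slitPlaneOver, mem_ofPred_eq, Complex.add_im, Complex.add_re, Complex.ofReal_im,
      Complex.ofReal_re, Complex.re_ofReal_mul, Complex.im_ofReal_mul, add_zero] at hw ⊢
    have ht3 : 0 ≤ t ^ 3 := by positivity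
    have ht3' : t ^ 3 ≤ 1 := pow_le_one₀ ht0 ht1
    rcases ht0.eq_or_lt with rfl | htpos
    · right; simpa using hI
    rcases hw with hw | hw
    · left; positivity
    · right
      have := (convex_Ioo p q) hI hw (a := 1 - t ^ 3) (b := t ^ 3) (by linarith) ht3 (by ring)
      convert this using 1
      simp only [smul_eq_mul]; ring
  -- `h '' G` is open, and by properness of `F` relatively closed, in the connected set `W`.
  have hsurj : W ⊆ h '' G := by
    have hopen : IsOpen (h '' G) := by
      rw [isOpen_iff_mem_nhds]
      rintro _ ⟨z, hz, rfl⟩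
      exact image_mem_nhds_of_deriv_ne_zero H.isOpen ha.differentiableOn hd hz
        (H.isOpen.mem_nhds hz)
    have h0W : (0 : ℂ) ∈ W := h0 ▸ hmaps H.zero_mem
    refine (hstar.isPathConnected h0W).isConnected.isPreconnected.subset_of_closure_inter_subset
      hopen ⟨0, h0W, 0, H.zero_mem, h0⟩ ?_
    rintro w ⟨hwc, hwW⟩
    obtain ⟨r, hr, hrW⟩ := nhds_basis_closedBall.mem_iff.1 (hWo.mem_nhds hwW)
    set L : Set ℂ := (fun w : ℂ => w ^ 3 + F 0) '' closedBall w r with hL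
    have hM : IsCompact (G ∩ F ⁻¹' L) := H.cover.proper L
      (by rintro _ ⟨u, hu, rfl⟩; exact hrW hu)
      ((isCompact_closedBall w r).image (by fun_prop))
    have hMc : IsClosed (h '' (G ∩ F ⁻¹' L)) :=
      (hM.image_of_continuousOn (ha.continuousOn.mono inter_subset_left)).isClosed
    have : w ∈ closure (h '' (G ∩ F ⁻¹' L)) := by
      rw [mem_closure_iff_nhds]
      intro t ht
      obtain ⟨_, ⟨hut, hur⟩, z, hz, rfl⟩ := mem_closure_iff_nhds.1 hwc _
        (inter_mem ht (closedBall_mem_nhds w hr))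
      exact ⟨h z, hut, z, ⟨hz, h z, hur, (hF z hz).symm⟩, rfl⟩
    rw [hMc.closure_eq] at this
    exact image_mono inter_subset_left this
  refine ⟨hmaps, ?_, hsurj⟩
  intro z₁ hz₁ z₂ hz₂ he
  by_cases hu : h z₁ = 0
  · rw [H.eq_zero_of_apply_eq hz₁ (by simp [hF z₁ hz₁, hu]),
      H.eq_zero_of_apply_eq hz₂ (by simp [hF z₂ hz₂, ← he, hu])]
  by_contra hne
  obtain ⟨ω, hω⟩ : ∃ ω : ℂ, IsPrimitiveRoot ω 3 := ⟨_, Complex.isPrimitiveRoot_exp 3 three_ne_zero⟩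
  have hω3 : ω ^ 3 = 1 := hω.pow_eq_one
  have hω1 : ω ≠ 1 := hω.ne_one (by norm_num)
  have hω0 : ω ≠ 0 := hω.ne_zero three_ne_zero
  -- `W` is invariant under cube roots of unity. Two points with the same nonzero value of `h`,
  -- together with preimages of its two rotations, would give four points in one fibre of `F`.
  have key : ∀ ζ : ℂ, ζ ^ 3 = 1 → ∃ z ∈ G, h z = ζ * h z₁ := by
    intro ζ hζ
    refine hsurj ?_
    change (ζ * h z₁) ^ 3 + F 0 ∈ slitPlaneOver (Ioo p q)
    rw [mul_pow, hζ, one_mul]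
    exact hmaps hz₁
  obtain ⟨z₃, hz₃, h3⟩ := key ω hω3
  obtain ⟨z₄, hz₄, h4⟩ := key (ω ^ 2) (by rw [← pow_mul, mul_comm, pow_mul, hω3, one_pow])
  have hcard := H.ncard_fibre (H.cover.mapsTo hz₁) (fun h2 => hu (by
    rw [H.eq_zero_of_apply_eq hz₁ h2, h0]))
  have n13 : ω * h z₁ ≠ h z₁ := fun h => hω1 (mul_right_cancel₀ hu (by rw [h, one_mul]))
  have n14 : ω ^ 2 * h z₁ ≠ h z₁ := fun h => hω1 (by
    have : ω ^ 2 = 1 := mul_right_cancel₀ hu (by rw [h, one_mul])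
    rw [pow_succ, this, one_mul] at hω3
    exact hω3)
  have n34 : ω ^ 2 * h z₁ ≠ ω * h z₁ := fun h => hω1 (by
    have := mul_right_cancel₀ hu h
    rw [sq] at this
    exact mul_right_cancel₀ hω0 (by rw [this, one_mul]))
  have hsub : (({z₁, z₂, z₃, z₄} : Finset ℂ) : Set ℂ) ⊆ G ∩ F ⁻¹' {F z₁} := by
    have e3 : (ω ^ 2) ^ 3 = 1 := by rw [← pow_mul, mul_comm, pow_mul, hω3, one_pow]
    intro x hx
    simp only [Finset.coe_insert, Finset.coe_singleton, mem_insert_iff, mem_singleton_iff] at hx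
    rcases hx with rfl | rfl | rfl | rfl
    · exact ⟨hz₁, rfl⟩
    · exact ⟨hz₂, by simp [hF _ hz₁, hF _ hz₂, he]⟩
    · exact ⟨hz₃, by simp [hF _ hz₁, hF _ hz₃, h3, mul_pow, hω3]⟩
    · exact ⟨hz₄, by simp only [mem_preimage, mem_singleton_iff, hF _ hz₁, hF _ hz₄, h4, mul_pow,
        e3, one_mul]⟩
  have hle := ncard_le_ncard hsub (finite_of_ncard_ne_zero (by rw [hcard]; norm_num))
  rw [hcard, ncard_coe_finset] at hle
  have n1 : z₁ ≠ z₃ := fun h => n13 (by rw [← h3, h])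
  have n2 : z₁ ≠ z₄ := fun h => n14 (by rw [← h4, h])
  have n3 : z₂ ≠ z₃ := fun h => n13 (by rw [← h3, ← h, he])
  have n4 : z₂ ≠ z₄ := fun h => n14 (by rw [← h4, ← h, he])
  have n5 : z₃ ≠ z₄ := fun h => n34 (by rw [← h4, ← h3, h])
  rw [Finset.card_insert_of_notMem (by simp [hne, n1, n2]),
    Finset.card_insert_of_notMem (by simp [n3, n4]), Finset.card_pair n5] at hle
  omega

end IsEpsteinMap

/-! ### Existence of the univalent factor -/

namespace IsEpsteinMap

variable {a p q : ℝ} {g : ℝ → ℝ} {G : Set ℂ} {F : ℂ → ℂ}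

/-- The cube root of `F - F 0` can be chosen positive on `(0,a]`. -/
lemma exists_cubeRoot_real (H : IsEpsteinMap a g p q G F) :
    ∃ h : ℂ → ℂ, AnalyticOnNhd ℂ h G ∧ (∀ z ∈ G, F z = h z ^ 3 + F 0) ∧
      ∀ x ∈ Icc 0 a, h (x : ℂ) = (((g x - g 0) ^ (1 / 3 : ℝ) : ℝ) : ℂ) := by
  obtain ⟨h, ha, hF⟩ := H.exists_cubeRoot
  set r : ℝ → ℝ := fun x => (g x - g 0) ^ (1 / 3 : ℝ) with hr
  have hr3 : ∀ x ∈ Icc 0 a, r x ^ 3 = g x - g 0 := by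
    intro x hx
    have : 0 ≤ g x - g 0 := sub_nonneg.2 (H.strictMonoOn.monotoneOn ⟨le_rfl, H.a_pos.le⟩ hx hx.1)
    rw [hr, ← Real.rpow_natCast, ← Real.rpow_mul this]
    norm_num
  have hrpos : ∀ x ∈ Ioc 0 a, 0 < r x := fun x hx =>
    Real.rpow_pos_of_pos (sub_pos.2 (H.lt_of_pos hx)) _
  have hh3 : ∀ x ∈ Icc 0 a, h (x : ℂ) ^ 3 = (r x : ℂ) ^ 3 := by
    intro x hx
    have h1 := hF x (H.interval_subset x hx)
    rw [H.extends_map x hx, H.apply_zero] at h1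
    rw [← Complex.ofReal_pow, hr3 x hx, Complex.ofReal_sub]
    linear_combination -h1
  have hamem : a ∈ Ioc 0 a := ⟨H.a_pos, le_rfl⟩
  have hrne : ∀ x ∈ Ioc 0 a, (r x : ℂ) ≠ 0 := fun x hx => by exact_mod_cast (hrpos x hx).ne'
  have hcont : ContinuousOn (fun x : ℝ => h x / r x) (Ioc 0 a) := by
    refine ContinuousOn.div ?_ ?_ hrne
    · exact ha.continuousOn.comp Complex.continuous_ofReal.continuousOn
        fun x hx => H.interval_subset x ⟨hx.1.le, hx.2⟩
    · refine Complex.continuous_ofReal.comp_continuousOn (ContinuousOn.rpow_const ?_ ?_)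
      · exact (H.continuousOn.mono Ioc_subset_Icc_self).sub continuousOn_const
      · intro x hx; exact Or.inr (by norm_num)
  have hfin : {ζ : ℂ | ζ ^ 3 = 1}.Finite := by
    refine (Polynomial.nthRootsFinset 3 (1 : ℂ)).finite_toSet.subset fun ζ hζ => ?_
    exact (Polynomial.mem_nthRootsFinset (by norm_num) 1).2 hζ
  have hmaps : MapsTo (fun x : ℝ => h x / r x) (Ioc 0 a) {ζ : ℂ | ζ ^ 3 = 1} := by
    intro x hx
    change (h x / r x) ^ 3 = 1
    rw [div_pow, hh3 x ⟨hx.1.le, hx.2⟩, div_self (pow_ne_zero _ (hrne x hx))]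
  -- A continuous function on an interval with values in the finite set of cube roots of unity is
  -- constant; dividing by that constant makes `h` positive on `(0,a]`.
  have hconst : ∀ x ∈ Ioc 0 a, h x / r x = h a / r a := fun x hx =>
    isPreconnected_Ioc.constant_of_mapsTo hfin.isDiscrete hcont hmaps hx hamem
  set ω : ℂ := h a / r a with hω
  have hω3 : ω ^ 3 = 1 := hmaps hamem
  have hω0 : ω ≠ 0 := by rintro h0; rw [h0] at hω3; norm_num at hω3
  have hi3 : ω⁻¹ ^ 3 = 1 := by rw [inv_pow, hω3, inv_one]
  refine ⟨fun z => ω⁻¹ * h z, analyticOnNhd_const.mul ha, fun z hz => ?_, fun x hx => ?_⟩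
  · rw [mul_pow, hi3, one_mul, hF z hz]
  · change ω⁻¹ * h x = (r x : ℂ)
    rcases hx.1.eq_or_lt with rfl | hx0
    · have h1 := hh3 0 hx
      have h2 : r 0 = 0 := by simp [hr]
      rw [h2] at h1 ⊢
      simp only [Complex.ofReal_zero, ne_eq, OfNat.ofNat_ne_zero, not_false_eq_true, zero_pow,
        pow_eq_zero_iff] at h1
      simp [h1]
    · have h1 := hconst x ⟨hx0, hx.2⟩
      rw [div_eq_iff (hrne x ⟨hx0, hx.2⟩)] at h1
      rw [h1]
      field_simp

/-- Every Epstein map has a univalent factor. -/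
lemma exists_isCubicDecomposition (H : IsEpsteinMap a g p q G F) :
    ∃ (c : ℂ) (b : ℝ) (h : ℂ → ℂ), IsCubicDecomposition a p q G F c b h := by
  obtain ⟨h, ha, hF, hx⟩ := H.exists_cubeRoot_real
  set r : ℝ → ℝ := fun x => (g x - g 0) ^ (1 / 3 : ℝ) with hr
  have hr0 : r 0 = 0 := by simp [hr]
  have hmono : MonotoneOn r (Icc 0 a) := by
    intro x hx y hy hxy
    have h0 : ∀ x ∈ Icc 0 a, 0 ≤ g x - g 0 := fun x hx =>
      sub_nonneg.2 (H.strictMonoOn.monotoneOn ⟨le_rfl, H.a_pos.le⟩ hx hx.1)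
    exact Real.rpow_le_rpow (h0 x hx)
      (sub_le_sub_right (H.strictMonoOn.monotoneOn hx hy hxy) _) (by norm_num)
  have hcont : ContinuousOn r (Icc 0 a) :=
    (H.continuousOn.sub continuousOn_const).rpow_const fun x _ => Or.inr (by norm_num)
  have himg : r '' Icc 0 a = Icc 0 (r a) := by
    refine Subset.antisymm ?_ ?_
    · rintro _ ⟨x, hx, rfl⟩
      exact ⟨hr0 ▸ hmono ⟨le_rfl, H.a_pos.le⟩ hx hx.1, hmono hx ⟨H.a_pos.le, le_rfl⟩ hx.2⟩
    · have := intermediate_value_Icc H.a_pos.le hcont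
      rwa [hr0] at this
  refine ⟨F 0, r a, h, ?_, ha, H.bijOn_cubeRoot ha hF, ?_, hF⟩
  · exact Real.rpow_pos_of_pos (sub_pos.2 (H.lt_of_pos ⟨H.a_pos, le_rfl⟩)) _
  · rw [← himg, image_image, image_image]
    exact image_congr hx

end IsEpsteinMap

/-! ### Normalization of an arbitrary univalent factor -/

namespace IsCubicDecomposition

variable {a p q b : ℝ} {g : ℝ → ℝ} {G : Set ℂ} {F h : ℂ → ℂ} {c : ℂ}

lemma exists_real (D : IsCubicDecomposition a p q G F c b h) {x : ℝ} (hx : x ∈ Icc 0 a) :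
    ∃ t ∈ Icc 0 b, h x = (t : ℂ) := by
  have : h x ∈ (fun x : ℝ => (x : ℂ)) '' Icc 0 b := by
    rw [← D.image_interval]
    exact mem_image_of_mem _ (mem_image_of_mem _ hx)
  obtain ⟨t, ht, e⟩ := this
  exact ⟨t, ht, e.symm⟩

lemma exists_preimage (D : IsCubicDecomposition a p q G F c b h) {t : ℝ} (ht : t ∈ Icc 0 b) :
    ∃ x ∈ Icc 0 a, h ((x : ℝ) : ℂ) = (t : ℂ) := by
  have : (t : ℂ) ∈ h '' ((fun x : ℝ => (x : ℂ)) '' Icc 0 a) := by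
    rw [D.image_interval]
    exact mem_image_of_mem _ ht
  obtain ⟨_, ⟨x, hx, rfl⟩, e⟩ := this
  exact ⟨x, hx, e⟩

/-- Rules out an orientation-reversing `h` on the interval: if `h x = 0` then `g x = c ≤ g 0`, and
monotonicity of `g` gives `x = 0`. -/
lemma map_zero (D : IsCubicDecomposition a p q G F c b h) (H : IsEpsteinMap a g p q G F) :
    h 0 = 0 := by
  have h0a : (0 : ℝ) ∈ Icc 0 a := ⟨le_rfl, H.a_pos.le⟩
  obtain ⟨x, hx, hx0⟩ := D.exists_preimage (t := 0) ⟨le_rfl, D.b_pos.le⟩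
  obtain ⟨t, ht, ht0⟩ := D.exists_real h0a
  have e1 := D.eq_comp x (H.interval_subset x hx)
  have e2 := D.eq_comp (0 : ℝ) (H.interval_subset 0 h0a)
  rw [H.extends_map x hx, hx0] at e1
  rw [H.extends_map 0 h0a, ht0] at e2
  have e3 : ((g 0 : ℝ) : ℂ) = ((t ^ 3 + g x : ℝ) : ℂ) := by
    push_cast
    rw [e2, e1]; simp
  have e4 : g 0 = t ^ 3 + g x := by exact_mod_cast e3
  have e5 : g x ≤ g 0 := by have := pow_nonneg ht.1 3; linarith
  have e6 : x = 0 := le_antisymm ((H.strictMonoOn.le_iff_le hx h0a).1 e5) hx.1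
  rw [e6] at hx0
  simpa using hx0

lemma eq_apply_zero (D : IsCubicDecomposition a p q G F c b h) (H : IsEpsteinMap a g p q G F) :
    c = F 0 := by
  rw [D.eq_comp 0 H.zero_mem, D.map_zero H]; simp

lemma map_right (D : IsCubicDecomposition a p q G F c b h) (H : IsEpsteinMap a g p q G F) :
    h a = b := by
  have haa : a ∈ Icc 0 a := ⟨H.a_pos.le, le_rfl⟩
  obtain ⟨x, hx, hxb⟩ := D.exists_preimage (t := b) ⟨D.b_pos.le, le_rfl⟩
  obtain ⟨t, ht, hta⟩ := D.exists_real haa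
  have e1 := D.eq_comp x (H.interval_subset x hx)
  have e2 := D.eq_comp a (H.interval_subset a haa)
  rw [H.extends_map x hx, hxb] at e1
  rw [H.extends_map a haa, hta] at e2
  have e3 : ((g a - g x : ℝ) : ℂ) = ((t ^ 3 - b ^ 3 : ℝ) : ℂ) := by
    push_cast
    rw [e2, e1]; ring
  have e4 : g a - g x = t ^ 3 - b ^ 3 := by exact_mod_cast e3
  have e5 : t ^ 3 ≤ b ^ 3 := pow_le_pow_left₀ ht.1 ht.2 3
  have e6 : x = a := le_antisymm hx.2 ((H.strictMonoOn.le_iff_le haa hx).1 (by linarith))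
  rw [← e6, hxb]

/-- Identifies `b` as the scale that turns the space around `J` into a bound in `s` alone. -/
lemma cube_eq (D : IsCubicDecomposition a p q G F c b h) (H : IsEpsteinMap a g p q G F) :
    b ^ 3 = g a - g 0 := by
  have haa : a ∈ Icc 0 a := ⟨H.a_pos.le, le_rfl⟩
  have e := D.eq_comp a (H.interval_subset a haa)
  rw [H.extends_map a haa, D.map_right H, D.eq_apply_zero H, H.apply_zero] at e
  have : g a = b ^ 3 + g 0 := by exact_mod_cast e
  linarith

lemma deriv_ne_zero (D : IsCubicDecomposition a p q G F c b h) (H : IsEpsteinMap a g p q G F)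
    {z : ℂ} (hz : z ∈ G) : deriv h z ≠ 0 :=
  H.deriv_ne_zero D.analytic (D.map_zero H)
    (fun w hw => by rw [D.eq_comp w hw, ← D.eq_apply_zero H]) hz

end IsCubicDecomposition

/-! ### The uniform domain and distortion bound -/

theorem mainTheorem7 (s : ℝ) (hs0 : 0 < s) (hs1 : s < 1) :
    ∃ (O : Set ℂ) (K : ℝ), IsOpen O ∧ IsConnected O ∧ (∀ x ∈ Set.Icc (0 : ℝ) 1, (x : ℂ) ∈ O) ∧
      ∀ (g : ℝ → ℝ) (p q : ℝ) (G : Set ℂ) (F : ℂ → ℂ), IsEpsteinMapWith s 1 g p q G F →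
        O ⊆ G ∧
        (∃ (c : ℂ) (b : ℝ) (h : ℂ → ℂ), IsCubicDecomposition 1 p q G F c b h) ∧
        ∀ (c : ℂ) (b : ℝ) (h : ℂ → ℂ), IsCubicDecomposition 1 p q G F c b h →
          HasBoundedDistortion K h O := by
  set U : Set ℂ := {u | u ^ 3 ∈ slitPlaneOver (Ioo (-s) (1 + s))} with hUdef
  have hU : IsOpen U :=
    (isOpen_slitPlaneOver isOpen_Ioo).preimage (by fun_prop : Continuous fun u : ℂ => u ^ 3)
  have hIU : ∀ x ∈ Icc (0 : ℝ) 1, (x : ℂ) ∈ U := by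
    intro x hx
    change (x : ℂ) ^ 3 ∈ slitPlaneOver (Ioo (-s) (1 + s))
    rw [← Complex.ofReal_pow]
    refine Or.inr ⟨?_, ?_⟩
    · rw [Complex.ofReal_re]; linarith [pow_nonneg hx.1 3]
    · rw [Complex.ofReal_re]; linarith [pow_le_one₀ hx.1 hx.2 (n := 3)]
  obtain ⟨δ, hδ, K, hK, hφ⟩ := exists_uniform_koebe_unitInterval hU hIU
  set I : Set ℂ := (fun x : ℝ => (x : ℂ)) '' Icc 0 1 with hI
  have hIconv : Convex ℝ I := by
    have := (convex_Icc (0 : ℝ) 1).is_linear_image Complex.ofRealCLM.isLinear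
    exact this
  have hIsub : ∀ x ∈ Icc (0 : ℝ) 1, (x : ℂ) ∈ thickening δ I := fun x hx =>
    self_subset_thickening hδ I (mem_image_of_mem _ hx)
  -- the rescaled inverse of the univalent factor has all properties needed for the uniform bounds
  have main : ∀ (g : ℝ → ℝ) (p q : ℝ) (G : Set ℂ) (F : ℂ → ℂ), IsEpsteinMapWith s 1 g p q G F →
      ∀ (c : ℂ) (b : ℝ) (h : ℂ → ℂ), IsCubicDecomposition 1 p q G F c b h →
        thickening δ I ⊆ G ∧ HasBoundedDistortion K h (thickening δ I) := by
    intro g p q G F H c b h D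
    have H' := H.toIsEpsteinMap
    have hb : (b : ℂ) ≠ 0 := by exact_mod_cast D.b_pos.ne'
    have hbn : 0 < ‖(b : ℂ)‖ := norm_pos_iff.2 hb
    -- The affine map `v ↦ |J| v + g 0` sends `(-s, 1 + s)` into `(p, q)` by the space conditions.
    have hW : ∀ u ∈ U, b * u ∈ h '' G := by
      intro u hu
      rw [D.bijOn.image_eq]
      change (b * u) ^ 3 + c ∈ slitPlaneOver (Ioo p q)
      have hb3 : 0 < b ^ 3 := pow_pos D.b_pos 3
      have e3 := D.cube_eq H'
      have e : (b * u) ^ 3 + c = ((b ^ 3 : ℝ) : ℂ) * u ^ 3 + ((g 0 : ℝ) : ℂ) := by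
        rw [D.eq_apply_zero H', H'.apply_zero, mul_pow]; push_cast; ring
      have hl := H.left_space
      have hr := H.right_space
      rw [← e3] at hl hr
      rw [e]
      change (u ^ 3).im ≠ 0 ∨ (u ^ 3).re ∈ Ioo (-s) (1 + s) at hu
      change (((b ^ 3 : ℝ) : ℂ) * u ^ 3 + ((g 0 : ℝ) : ℂ)).im ≠ 0 ∨
        (((b ^ 3 : ℝ) : ℂ) * u ^ 3 + ((g 0 : ℝ) : ℂ)).re ∈ Ioo p q
      rw [Complex.add_im, Complex.add_re, Complex.ofReal_im, Complex.ofReal_re,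
        Complex.re_ofReal_mul, Complex.im_ofReal_mul, add_zero]
      refine hu.imp (fun h1 => mul_ne_zero hb3.ne' h1) fun h1 => ⟨?_, ?_⟩
      · nlinarith [h1.1]
      · nlinarith [h1.2]
    set ψ := Function.invFunOn h G with hψ
    have hψh : ∀ z ∈ G, ψ (h z) = z := fun z hz => D.bijOn.injOn.leftInvOn_invFunOn hz
    have hψG : ∀ u ∈ U, ψ (b * u) ∈ G := fun u hu => Function.invFunOn_mem (hW u hu)
    have hhψ : ∀ u ∈ U, h (ψ (b * u)) = b * u := fun u hu => Function.invFunOn_eq (hW u hu)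
    have hder : ∀ u ∈ U, HasDerivAt (fun u => ψ (b * u)) (b / deriv h (ψ (b * u))) u := by
      intro u hu
      have h1 := hasDerivAt_invFunOn H'.isOpen D.analytic.differentiableOn D.bijOn.injOn
        (fun z hz => D.deriv_ne_zero H' hz) (hψG u hu)
      rw [hhψ u hu] at h1
      have h2 : HasDerivAt (fun u : ℂ => b * u) (b : ℂ) u := by
        simpa using (hasDerivAt_id u).const_mul (b : ℂ)
      exact (h1.comp u h2).congr_deriv (by rw [div_eq_inv_mul])
    obtain ⟨S, hSU, hcov, hdist⟩ := hφ (fun u => ψ (b * u))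
      (fun u hu => (hder u hu).differentiableAt.differentiableWithinAt)
      (by
        intro u hu v hv huv
        have := congrArg h huv
        simp only [hhψ u hu, hhψ v hv] at this
        exact mul_left_cancel₀ hb this)
      (fun u hu => by
        rw [(hder u hu).deriv]
        exact div_ne_zero hb (D.deriv_ne_zero H' (hψG u hu)))
      (by
        have := hψh 0 H'.zero_mem
        rw [D.map_zero H'] at this
        simpa using this)
      (by
        have h1 := hψh (1 : ℝ) (H'.interval_subset 1 ⟨zero_le_one, le_rfl⟩)
        rw [D.map_right H'] at h1
        simpa using h1)
    -- A point `x` of `[0,1]` is `φ (t / b)` with `t = h x ∈ [0,b]`, so the covered disks are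
    -- centred at all points of `I`.
    have hlift : ∀ z ∈ thickening δ I, ∃ u ∈ S, ψ (b * u) = z := by
      intro z hz
      obtain ⟨_, ⟨x, hx, rfl⟩, hzx⟩ := mem_thickening_iff.1 hz
      obtain ⟨t, ht, htx⟩ := D.exists_real hx
      have h1 : ψ (b * ((t / b : ℝ) : ℂ)) = x := by
        rw [Complex.ofReal_div, mul_div_cancel₀ _ hb, ← htx]
        exact hψh x (H'.interval_subset x hx)
      refine hcov (t / b) ⟨div_nonneg ht.1 D.b_pos.le, (div_le_one D.b_pos).2 ht.2⟩ ?_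
      rw [h1]
      exact hzx
    refine ⟨fun z hz => ?_, fun z hz w hw => ?_⟩
    · obtain ⟨u, hu, rfl⟩ := hlift z hz
      exact hψG u (hSU hu)
    · obtain ⟨u, hu, rfl⟩ := hlift z hz
      obtain ⟨v, hv, rfl⟩ := hlift w hw
      -- The arguments are swapped because `φ' = b / h'` inverts ratios of derivatives.
      have h1 := hdist v hv u hu
      have hu0 := norm_pos_iff.2 (D.deriv_ne_zero H' (hψG u (hSU hu)))
      have hv0 := norm_pos_iff.2 (D.deriv_ne_zero H' (hψG v (hSU hv)))
      rw [(hder u (hSU hu)).deriv, (hder v (hSU hv)).deriv, norm_div, norm_div, ← mul_div_assoc,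
        div_le_div_iff₀ hv0 hu0] at h1
      have h2 : ‖(b : ℂ)‖ * ‖deriv h (ψ (b * u))‖ ≤
          ‖(b : ℂ)‖ * (K * ‖deriv h (ψ (b * v))‖) := by linarith
      exact le_of_mul_le_mul_left h2 hbn
  refine ⟨thickening δ I, K, isOpen_thickening,
    ⟨⟨_, hIsub 0 ⟨le_rfl, zero_le_one⟩⟩, (hIconv.thickening δ).isPreconnected⟩, hIsub, ?_⟩
  intro g p q G F H
  obtain ⟨c, b, h, D⟩ := H.toIsEpsteinMap.exists_isCubicDecomposition
  exact ⟨(main g p q G F H c b h D).1, ⟨c, b, h, D⟩,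
    fun c b h D => (main g p q G F H c b h D).2⟩
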